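/- Let $R$ be a commutative ring with unit which is coherent (every finitely generated ideal is finitely presented) and regular (every finitely generated ideal has finite projective dimension). Let $\mathcal C$ be a wide subcategory of the category of finitely presented $R$-modules, i.e. a non-empty full subcategory, all of whose objects are finitely presented, that is closed under kernels and cokernels of its morphisms and under extensions; in particular $\mathcal C$ is an abelian category. Let $\mathrm{Thick}(R)$ be the category of perfect complexes, i.e. the smallest full triangulated subcategory of the derived category $D(R)$ that contains $R$ (in degree $0$) and is closed under direct summands, and let $$f(\mathcal C)=\{X\in \mathrm{Thick}(R) : H_n(X)\in\mathcal C \text{ for all } n\in\mathbb Z\},$$ which is a thick subcategory of $D(R)$ (homological grading is used). The Grothendieck group $K_0(\mathcal A)$ of an abelian category $\mathcal A$ is the free abelian group on the isomorphism classes of objects of $\mathcal A$ modulo the relations $[B]=[A]+[C]$ for all short exact sequences $0\to A\to B\to C\to 0$ in $\mathcal A$; for a triangulated category, the relations are $[B]=[A]+[C]$ for all exact triangles $A\to B\to C\to\Sigma A$. Then for every $M\in\mathcal C$ the complex $M[0]$ (that is, $M$ concentrated in degree $0$) lies in $f(\mathcal C)$; for every $X\in f(\mathcal C)$ only finitely many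 homology modules $H_i(X)$ are non-zero; and there is an isomorphism of abelian groups $$K_0(\mathcal C)\;\cong\; K_0(f(\mathcal C)),\qquad [M]\longmapsto [M[0]],$$ whose inverse is given by $[X]\longmapsto \sum_{i\in\mathbb Z}(-1)^i[H_i(X)]$. -/

import Mathlib

open CategoryTheory Limits Pretriangulated
open scoped ZeroObject

universe w v u

namespace WideSubcategory

/-! ### Rings -/

/-- A commutative ring is coherent if every finitely generated ideal is finitely presented. -/
def IsCoherentRing (R : Type u) [CommRing R] : Prop :=
  ∀ I : Ideal R, I.FG → Module.FinitePresentation R I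

/-- A commutative (not necessarily noetherian) ring is regular if every finitely generated ideal
has finite projective dimension. -/
def IsRegularCommRing (R : Type u) [CommRing R] : Prop :=
  ∀ I : Ideal R, I.FG → ∃ n : ℕ, HasProjectiveDimensionLE (ModuleCat.of R I) n

/-! ### Wide subcategories -/

section Wide

variable {A : Type u} [Category.{v} A] [Abelian A]

/-- A full subcategory of an abelian category, given by a property `W` of objects, is wide if it is
a non-empty abelian subcategory (closed under kernels and cokernels of its morphisms) which is
closed under extensions. -/
class IsWide (W : ObjectProperty A) : Prop extends W.Nonempty, W.IsClosedUnderKernels,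
  W.IsClosedUnderCokernels, W.IsClosedUnderExtensions

variable (W : ObjectProperty A) [hW : IsWide W]

theorem IsWide.prop_zero_of_isZero {Z : A} (hZ : IsZero Z) : W Z := by
  obtain ⟨X, hX⟩ := hW.toNonempty
  exact W.prop_of_isColimit_cokernelCofork (f := 𝟙 X) (k := CokernelCofork.ofπ (0 : X ⟶ Z) (by simp))
    (CokernelCofork.IsColimit.ofπ _ _ (fun _ _ => 0)
      (fun g hg => by rw [Category.id_comp] at hg; simp [hg])
      (fun _ _ _ _ => hZ.eq_of_src _ _)) hX hX

instance IsWide.containsZero : W.ContainsZero :=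
  ⟨⟨0, isZero_zero A, IsWide.prop_zero_of_isZero W (isZero_zero A)⟩⟩

instance IsWide.isClosedUnderIsomorphisms : W.IsClosedUnderIsomorphisms where
  of_iso {X Y} e hX := by
    refine W.prop_of_isLimit_kernelFork (f := (0 : X ⟶ X))
      (k := KernelFork.ofι e.inv (by simp)) ?_ hX hX
    exact KernelFork.IsLimit.ofι _ _ (fun g _ => g ≫ e.hom) (by simp)
      (fun g _ m hm => by simp [← hm])

instance IsWide.isClosedUnderFiniteProducts : W.IsClosedUnderFiniteProducts := by
  have : W.IsClosedUnderBinaryProducts := by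
    constructor
    rintro X ⟨p⟩
    refine W.prop_of_iso ?_ (W.prop_biprod (p.prop_diag_obj (.mk .left))
      (p.prop_diag_obj (.mk .right)))
    exact IsLimit.conePointUniqueUpToIso (BinaryBiproduct.isLimit _ _)
      ((IsLimit.postcomposeHomEquiv (diagramIsoPair p.diag) _).2 p.isLimit)
  exact .mk'

/-- A retract of an object is the kernel of an idempotent. -/
instance IsWide.isStableUnderRetracts : W.IsStableUnderRetracts where
  of_retract {X Y} r hY := by
    refine W.prop_of_isLimit_kernelFork (f := 𝟙 Y - r.r ≫ r.i)
      (k := KernelFork.ofι r.i (by simp)) ?_ hY hY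
    refine KernelFork.IsLimit.ofι _ _ (fun g _ => g ≫ r.r) (fun g hg => ?_)
      (fun g _ m hm => by simp [← hm])
    rw [Preadditive.comp_sub, Category.comp_id, sub_eq_zero] at hg
    rw [Category.assoc, ← hg]

/-- In an exact sequence `A₀ ⟶ A₁ ⟶ A₂ ⟶ A₃ ⟶ A₄`, the middle term belongs to a wide subcategory
if the four outer ones do. -/
theorem IsWide.prop_of_exact {A₀ A₁ A₂ A₃ A₄ : A} (a : A₀ ⟶ A₁) (b : A₁ ⟶ A₂) (c : A₂ ⟶ A₃)
    (d : A₃ ⟶ A₄) (hab : a ≫ b = 0) (hbc : b ≫ c = 0) (hcd : c ≫ d = 0)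
    (e₁ : (ShortComplex.mk a b hab).Exact) (e₂ : (ShortComplex.mk b c hbc).Exact)
    (e₃ : (ShortComplex.mk c d hcd).Exact) (h₀ : W A₀) (h₁ : W A₁) (h₃ : W A₃) (h₄ : W A₄) :
    W A₂ := by
  have hm : Mono (cokernel.desc a b hab) := e₁.mono_cokernelDesc
  have he : Epi (kernel.lift d c hcd) := e₃.epi_kernelLift
  have hz : cokernel.desc a b hab ≫ kernel.lift d c hcd = 0 := by
    rw [← cancel_epi (cokernel.π a), ← cancel_mono (kernel.ι d)]
    simp [hbc]
  let S := ShortComplex.mk _ _ hz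
  have hS : S.Exact := by
    rw [ShortComplex.exact_iff_exact_up_to_refinements]
    intro T x hx
    have hx' : x ≫ c = 0 := by
      have := hx =≫ kernel.ι d
      simpa [S] using this
    obtain ⟨T', π, hπ, y, hy⟩ := e₂.exact_up_to_refinements x hx'
    exact ⟨T', π, hπ, y ≫ cokernel.π a, by simpa [S] using hy⟩
  exact W.prop_X₂_of_shortExact (S := S) ⟨hS⟩ (W.prop_cokernel a h₀ h₁) (W.prop_kernel d h₃ h₄)

end Wide

/-! ### Grothendieck groups -/

/-- The type of isomorphism classes of objects of a category. -/
abbrev IsoClasses (A : Type u) [Category.{v} A] : Type u := Quotient (isIsomorphicSetoid A)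

/-- The generator of the free abelian group on isomorphism classes given by an object. -/
def freeClass {A : Type u} [Category.{v} A] (X : A) : FreeAbelianGroup (IsoClasses A) :=
  FreeAbelianGroup.of (Quotient.mk (isIsomorphicSetoid A) X)

/-- The elements `[S.X₂] - ([S.X₁] + [S.X₃])` for all short exact sequences
`0 ⟶ S.X₁ ⟶ S.X₂ ⟶ S.X₃ ⟶ 0`. -/
def shortExactRelations (A : Type u) [Category.{v} A] [Abelian A] :
    Set (FreeAbelianGroup (IsoClasses A)) :=
  {x | ∃ S : ShortComplex A, S.ShortExact ∧
    x = freeClass S.X₂ - (freeClass S.X₁ + freeClass S.X₃)}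

/-- The Grothendieck group of an abelian category. -/
abbrev AbelianK₀ (A : Type u) [Category.{v} A] [Abelian A] : Type u :=
  FreeAbelianGroup (IsoClasses A) ⧸ AddSubgroup.closure (shortExactRelations A)

/-- The class `[X]` of an object in the Grothendieck group of an abelian category. -/
def AbelianK₀.mk {A : Type u} [Category.{v} A] [Abelian A] (X : A) : AbelianK₀ A :=
  QuotientAddGroup.mk (freeClass X)

section Triangulated

variable (T : Type u) [Category.{v} T] [HasZeroObject T] [HasShift T ℤ] [Preadditive T]
  [∀ n : ℤ, (shiftFunctor T n).Additive] [Pretriangulated T]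

/-- The elements `[B] - ([A] + [C])` for all exact triangles `A ⟶ B ⟶ C ⟶ ΣA`. -/
def triangleRelations : Set (FreeAbelianGroup (IsoClasses T)) :=
  {x | ∃ D : Triangle T, D ∈ distTriang T ∧
    x = freeClass D.obj₂ - (freeClass D.obj₁ + freeClass D.obj₃)}

/-- The Grothendieck group of a triangulated category. -/
abbrev TriangulatedK₀ : Type u :=
  FreeAbelianGroup (IsoClasses T) ⧸ AddSubgroup.closure (triangleRelations T)

variable {T} in
/-- The class `[X]` of an object in the Grothendieck group of a triangulated category. -/
def TriangulatedK₀.mk (X : T) : TriangulatedK₀ T :=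
  QuotientAddGroup.mk (freeClass X)

end Triangulated

/-! ### Perfect complexes -/

section Perfect

variable (R : Type u) [CommRing R] [HasDerivedCategory.{w} (ModuleCat.{u} R)]

/-- The complex `M[0]` in `D(R)` which is the module `M` concentrated in degree zero. -/
noncomputable abbrev inDegreeZero (M : ModuleCat.{u} R) : DerivedCategory (ModuleCat.{u} R) :=
  (DerivedCategory.singleFunctor (ModuleCat.{u} R) 0).obj M

/-- The homology module `H_i(X)`, in homological grading: Mathlib's derived category consists of
cochain complexes, and `H_i` is `H^{-i}`. -/
noncomputable abbrev homologyModule (i : ℤ) (X : DerivedCategory (ModuleCat.{u} R)) :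
    ModuleCat.{u} R :=
  (DerivedCategory.homologyFunctor (ModuleCat.{u} R) (-i)).obj X

/-- The perfect complexes (the small objects of `D(R)`): the thick subcategory of `D(R)` generated
by `R`, i.e. the smallest full triangulated subcategory which contains `R` in degree zero and is
closed under direct summands. -/
def perfectComplexes : ObjectProperty (DerivedCategory (ModuleCat.{u} R)) :=
  (ObjectProperty.singleton (inDegreeZero R (ModuleCat.of R R))).triangEnvelope

instance : (perfectComplexes R).IsTriangulated := by
  unfold perfectComplexes; infer_instance

instance : (perfectComplexes R).IsStableUnderRetracts := by
  unfold perfectComplexes; infer_instance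

variable {R}

/-- The complexes all of whose homology modules belong to `W`. -/
def homologyIn (W : ObjectProperty (ModuleCat.{u} R)) :
    ObjectProperty (DerivedCategory (ModuleCat.{u} R)) :=
  fun X => ∀ i : ℤ, W (homologyModule R i X)

theorem homologyIn_iff (W : ObjectProperty (ModuleCat.{u} R))
    (X : DerivedCategory (ModuleCat.{u} R)) :
    homologyIn W X ↔ ∀ n : ℤ, W ((DerivedCategory.homologyFunctor (ModuleCat.{u} R) n).obj X) :=
  ⟨fun h n => by simpa [homologyModule] using h (-n), fun h i => h (-i)⟩

/-- `f(W)`: the perfect complexes all of whose homology modules belong to `W`. -/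
def perfectWithHomologyIn (W : ObjectProperty (ModuleCat.{u} R)) :
    ObjectProperty (DerivedCategory (ModuleCat.{u} R)) :=
  perfectComplexes R ⊓ homologyIn W

variable (W : ObjectProperty (ModuleCat.{u} R)) [IsWide W]

instance : (homologyIn W).IsStableUnderRetracts where
  of_retract r hY i := W.prop_of_retract (r.map (DerivedCategory.homologyFunctor _ (-i))) (hY i)

instance : (homologyIn W).IsTriangulated where
  exists_zero := ⟨0, isZero_zero _, fun i => W.prop_of_isZero
    ((DerivedCategory.homologyFunctor _ (-i)).map_isZero (isZero_zero _))⟩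
  toIsStableUnderShift := ⟨fun a => ⟨fun X hX => by
    rw [homologyIn_iff] at hX
    change homologyIn W _
    rw [homologyIn_iff]
    intro n
    exact W.prop_of_iso (((DerivedCategory.homologyFunctor (ModuleCat.{u} R) 0).shiftIso a n (a + n)
      rfl).app X).symm (hX (a + n))⟩⟩
  toIsTriangulatedClosed₂ := .mk' (fun D hD h₁ h₃ => by
    rw [homologyIn_iff] at h₁ h₃ ⊢
    intro n
    exact IsWide.prop_of_exact W _ _ _ _ _ _ _
      (DerivedCategory.HomologySequence.exact₁ D hD (n - 1) n)
      (DerivedCategory.HomologySequence.exact₂ D hD n)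
      (DerivedCategory.HomologySequence.exact₃ D hD n (n + 1)) (h₃ _) (h₁ _) (h₃ _) (h₁ _))

/-- `f(W)` is a triangulated subcategory of `D(R)`; in particular it is a triangulated category,
whose exact triangles are those of `D(R)` with vertices in `f(W)`. -/
instance : (perfectWithHomologyIn W).IsTriangulated := by
  unfold perfectWithHomologyIn; infer_instance

/-- `f(W)` is closed under direct summands, hence thick. -/
instance : (perfectWithHomologyIn W).IsStableUnderRetracts where
  of_retract r hY := ⟨(perfectComplexes R).prop_of_retract r hY.1,
    (homologyIn W).prop_of_retract r hY.2⟩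

end Perfect

end WideSubcategory

open WideSubcategory

/-! Both maps descend to Grothendieck groups. Short exact sequences become triangles, so `M ↦ M[0]`
descends once every module in `W` is perfect. For the Euler characteristic, `wideClass_of_exact`
rewrites each three-term piece of the long exact homology sequence as the classes of two consecutive
kernels, and the alternating sum telescopes (`eulerChar_obj₂`). The sums are finite because perfect
complexes are bounded.

Perfectness is where the ring matters (`perfectModules_of_finitePresentation`). A finitely generated
submodule of `Rⁿ` is filtered by finitely generated ideals. By coherence syzygies stay finitely
presented, so finite projective dimension implies perfect; by regularity this applies to the ideals.

One composite is the identity because `M[0]` has only the homology module `M`. For the other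
(`inDegreeZeroHom_eulerChar`), truncation triangles peel off the top cohomology, leaving shifts of
modules `N[0]`. The truncations stay in `f(W)` because modules in `W` are perfect. -/

namespace WideSubcategory

/-! ### Finitely presented modules over a coherent regular ring are perfect -/

section Modules

variable {R : Type u} [CommRing R]

/-- A property of modules which is closed under extensions, contains the finitely generated ideals
and consists of finitely presented modules contains all finitely generated submodules of finite
free modules. -/
theorem prop_of_fg_submodule_pi (Q : ObjectProperty (ModuleCat.{u} R))
    [Q.IsClosedUnderIsomorphisms] [Q.IsClosedUnderExtensions]
    (hfp : ∀ M, Q M → Module.FinitePresentation R M)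
    (hI : ∀ I : Ideal R, I.FG → Q (ModuleCat.of R I)) (n : ℕ)
    (K : Submodule R (Fin n → R)) (hK : K.FG) : Q (ModuleCat.of R K) := by
  induction n with
  | zero =>
    refine Q.prop_of_iso (LinearEquiv.toModuleIso ?_) (hI ⊥ Submodule.fg_bot)
    have : Subsingleton K := inferInstance
    exact 0
  | succ n ih =>
    -- The image of the first coordinate is a finitely generated ideal. As it is finitely presented,
    -- the kernel is finitely generated, and the kernel embeds in `Rⁿ`, where induction applies.
    let f : K →ₗ[R] R := LinearMap.proj 0 ∘ₗ K.subtype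
    have : Module.Finite R K := Module.Finite.iff_fg.2 hK
    have hr : (LinearMap.range f).FG := Module.Finite.iff_fg.1 inferInstance
    have hQr : Q (ModuleCat.of R (LinearMap.range f)) := hI _ hr
    have := hfp _ hQr
    have hk : (LinearMap.ker f.rangeRestrict).FG :=
      Module.FinitePresentation.fg_ker _ f.surjective_rangeRestrict
    let t : LinearMap.ker f.rangeRestrict →ₗ[R] (Fin n → R) :=
      LinearMap.funLeft R R Fin.succ ∘ₗ K.subtype ∘ₗ Submodule.subtype _
    have ht : Function.Injective t := by
      rw [injective_iff_map_eq_zero]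
      rintro ⟨⟨x, hx⟩, hx0⟩ h
      have h0 : x 0 = 0 := by simpa [f, Subtype.ext_iff] using hx0
      have : x = 0 := by
        funext i
        refine Fin.cases h0 (fun j => ?_) i
        exact congrFun h j
      simp [this]
    have : Module.Finite R (LinearMap.ker f.rangeRestrict) := Module.Finite.iff_fg.2 hk
    have hker : Q (ModuleCat.of R (LinearMap.ker f.rangeRestrict)) :=
      Q.prop_of_iso (LinearEquiv.ofInjective t ht).symm.toModuleIso
        (ih (LinearMap.range t) (Module.Finite.iff_fg.1 inferInstance))
    exact Q.prop_X₂_of_shortExact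
      (LinearMap.shortExact_shortComplexKer f.surjective_rangeRestrict) hker hQr

variable (R) in
/-- The property of being a finitely presented module. -/
def finitelyPresented : ObjectProperty (ModuleCat.{u} R) :=
  fun M => Module.FinitePresentation R M

instance : (finitelyPresented R).IsClosedUnderIsomorphisms where
  of_iso e h := by
    have : Module.FinitePresentation R _ := h
    exact Module.FinitePresentation.of_equiv e.toLinearEquiv

instance : (finitelyPresented R).IsClosedUnderExtensions where
  prop_X₂_of_shortExact {S} hS h₁ h₃ := by
    have h₁' : Module.FinitePresentation R S.X₁ := h₁
    have h₃' : Module.FinitePresentation R S.X₃ := h₃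
    have e : S.X₁ ≃ₗ[R] LinearMap.ker S.g.hom :=
      (LinearEquiv.ofInjective S.f.hom hS.moduleCat_injective_f).trans
        (LinearEquiv.ofEq _ _ hS.exact.moduleCat_range_eq_ker)
    have := Module.FinitePresentation.of_equiv e
    exact Module.finitePresentation_of_ker S.g.hom hS.moduleCat_surjective_g

variable [HasDerivedCategory.{w} (ModuleCat.{u} R)]

variable (R) in
/-- The modules which are perfect when considered as complexes in degree zero. -/
def perfectModules : ObjectProperty (ModuleCat.{u} R) :=
  (perfectComplexes R).inverseImage (DerivedCategory.singleFunctor (ModuleCat.{u} R) 0)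

instance : (perfectModules R).IsClosedUnderIsomorphisms := by
  unfold perfectModules; infer_instance

instance : (perfectModules R).IsStableUnderRetracts where
  of_retract r h := (perfectComplexes R).prop_of_retract (r.map _) h

instance : (perfectModules R).IsClosedUnderExtensions where
  prop_X₂_of_shortExact hS h₁ h₃ :=
    (perfectComplexes R).ext_of_isTriangulatedClosed₂ _ hS.singleTriangle_distinguished h₁ h₃

theorem perfectModules_X₃_of_shortExact {S : ShortComplex (ModuleCat.{u} R)} (hS : S.ShortExact)
    (h₁ : perfectModules R S.X₁) (h₂ : perfectModules R S.X₂) : perfectModules R S.X₃ :=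
  (perfectComplexes R).ext_of_isTriangulatedClosed₃ _ hS.singleTriangle_distinguished h₁ h₂

theorem perfectModules_self : perfectModules R (ModuleCat.of R R) :=
  ObjectProperty.le_triangEnvelope _ _ (by simp)

theorem perfectModules_pi (n : ℕ) : perfectModules R (ModuleCat.of R (Fin n → R)) := by
  induction n with
  | zero =>
    have hz : IsZero (ModuleCat.of R (Fin 0 → R)) := ModuleCat.isZero_of_subsingleton _
    exact (perfectComplexes R).prop_of_isZero (Functor.map_isZero _ hz)
  | succ n ih =>
    let f : (Fin (n + 1) → R) →ₗ[R] R := LinearMap.proj 0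
    have hf : Function.Surjective f := fun x => ⟨fun _ => x, rfl⟩
    let e : LinearMap.ker f ≃ₗ[R] (Fin n → R) := LinearEquiv.ofBijective
      (LinearMap.funLeft R R Fin.succ ∘ₗ Submodule.subtype _) <| by
        constructor
        · rw [← LinearMap.ker_eq_bot, LinearMap.ker_eq_bot']
          rintro ⟨x, hx⟩ h
          ext i
          exact Fin.cases hx (fun j => congrFun h j) i
        · intro y
          exact ⟨⟨Fin.cons 0 y, by simp [f]⟩, by ext i; simp [LinearMap.funLeft]⟩
    exact (perfectModules R).prop_X₂_of_shortExact (LinearMap.shortExact_shortComplexKer hf)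
      ((perfectModules R).prop_of_iso e.symm.toModuleIso ih) perfectModules_self

/-- Over a coherent ring, a finitely presented module of finite projective dimension is perfect. -/
theorem perfectModules_of_hasProjectiveDimensionLE (hcoh : IsCoherentRing R) (d : ℕ)
    (M : ModuleCat.{u} R) [HasProjectiveDimensionLE M d] [Module.FinitePresentation R M] :
    perfectModules R M := by
  induction d generalizing M with
  | zero =>
    have hp : Projective M := (projective_iff_hasProjectiveDimensionLE_zero M).2 inferInstance
    rw [← IsProjective.iff_projective] at hp
    -- A finitely generated projective module is a direct summand of some `Rⁿ`.
    obtain ⟨n, f, g, -, -, hfg⟩ := Module.Finite.exists_comp_eq_id_of_projective R M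
    exact (perfectModules R).prop_of_retract (Y := ModuleCat.of R (Fin n → R))
      ⟨ModuleCat.ofHom g, ModuleCat.ofHom f, by ext x; exact LinearMap.congr_fun hfg x⟩
      (perfectModules_pi n)
  | succ d ih =>
    obtain ⟨n, f, hf⟩ := Module.Finite.exists_fin' R M
    have hK := Module.FinitePresentation.fg_ker f hf
    have hS := LinearMap.shortExact_shortComplexKer hf
    -- Coherence keeps the syzygy finitely presented, so the induction can continue.
    have hfp : Module.FinitePresentation R (LinearMap.ker f) :=
      prop_of_fg_submodule_pi (finitelyPresented R) (fun _ h => h) hcoh n _ hK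
    have hpi : Projective (ModuleCat.of R (Fin n → R)) :=
      (IsProjective.iff_projective _).1 inferInstance
    have : HasProjectiveDimensionLE (ModuleCat.of R (LinearMap.ker f)) d :=
      (hS.hasProjectiveDimensionLT_X₃_iff d hpi).1
        (inferInstanceAs (HasProjectiveDimensionLT M (d + 2)))
    exact perfectModules_X₃_of_shortExact hS (ih (ModuleCat.of R (LinearMap.ker f)))
      (perfectModules_pi n)

/-- Over a coherent regular ring, all finitely presented modules are perfect. -/
theorem perfectModules_of_finitePresentation (hcoh : IsCoherentRing R) (hreg : IsRegularCommRing R)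
    (M : ModuleCat.{u} R) [Module.FinitePresentation R M] : perfectModules R M := by
  obtain ⟨n, f, hf⟩ := Module.Finite.exists_fin' R M
  -- Finite presentation is built into `Q` because `prop_of_fg_submodule_pi` needs it. Filtering by
  -- ideals avoids bounding the projective dimension of `M` itself.
  let Q := finitelyPresented R ⊓ perfectModules R
  have : Q.IsClosedUnderExtensions := ⟨fun hS h₁ h₃ =>
    ⟨(finitelyPresented R).prop_X₂_of_shortExact hS h₁.1 h₃.1,
      (perfectModules R).prop_X₂_of_shortExact hS h₁.2 h₃.2⟩⟩
  have hI (I : Ideal R) (hI : I.FG) : Q (ModuleCat.of R I) := by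
    have hfp : Module.FinitePresentation R (ModuleCat.of R I) := hcoh I hI
    obtain ⟨d, _⟩ := hreg I hI
    exact ⟨hfp, perfectModules_of_hasProjectiveDimensionLE hcoh d _⟩
  exact perfectModules_X₃_of_shortExact (LinearMap.shortExact_shortComplexKer hf)
    (prop_of_fg_submodule_pi Q (fun _ h => h.1) hI n _ (Module.FinitePresentation.fg_ker f hf)).2
    (perfectModules_pi n)

end Modules

/-! ### Universal properties and basic relations of Grothendieck groups -/

section AbelianK₀

variable {A : Type u} [Category.{v} A] [Abelian A]

theorem freeClass_eq_of_iso {B : Type u} [Category.{v} B] {X Y : B} (e : X ≅ Y) :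
    freeClass X = freeClass Y :=
  congrArg FreeAbelianGroup.of (Quotient.sound ⟨e⟩)

/-- A function on objects which is invariant under isomorphisms, as a homomorphism from the free
abelian group on isomorphism classes. -/
def freeClassLift {B : Type u} [Category.{v} B] {G : Type*} [AddCommGroup G] (f : B → G)
    (hf : ∀ X Y : B, (X ≅ Y) → f X = f Y) : FreeAbelianGroup (IsoClasses B) →+ G :=
  FreeAbelianGroup.lift (Quotient.lift f (fun X Y h => h.elim (hf X Y)))

theorem freeClassLift_freeClass {B : Type u} [Category.{v} B] {G : Type*} [AddCommGroup G]
    (f : B → G) (hf : ∀ X Y : B, (X ≅ Y) → f X = f Y) (X : B) :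
    freeClassLift f hf (freeClass X) = f X :=
  FreeAbelianGroup.lift_apply_of _ _

theorem freeClass_hom_ext {B : Type u} [Category.{v} B] {G : Type*} [AddCommGroup G]
    {f g : FreeAbelianGroup (IsoClasses B) →+ G} (h : ∀ X, f (freeClass X) = g (freeClass X)) :
    f = g :=
  FreeAbelianGroup.lift_ext _ _ (fun x => Quotient.inductionOn x h)

namespace AbelianK₀

theorem mk_eq_of_iso {X Y : A} (e : X ≅ Y) : AbelianK₀.mk X = AbelianK₀.mk Y :=
  congrArg QuotientAddGroup.mk (freeClass_eq_of_iso e)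

theorem mk_X₂ {S : ShortComplex A} (hS : S.ShortExact) :
    AbelianK₀.mk S.X₂ = AbelianK₀.mk S.X₁ + AbelianK₀.mk S.X₃ := by
  rw [← sub_eq_zero]
  exact (QuotientAddGroup.eq_zero_iff _).2 (AddSubgroup.subset_closure ⟨S, hS, rfl⟩)

theorem mk_eq_zero {X : A} (hX : IsZero X) : AbelianK₀.mk X = 0 := by
  have hS : (ShortComplex.mk (0 : X ⟶ X) (0 : X ⟶ X) (by simp)).ShortExact :=
    { exact := ShortComplex.exact_of_isZero_X₂ _ hX
      mono_f := ⟨fun _ _ _ => hX.eq_of_tgt _ _⟩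
      epi_g := ⟨fun _ _ _ => hX.eq_of_src _ _⟩ }
  simpa using mk_X₂ hS

/-- The universal property of the Grothendieck group of an abelian category. -/
def lift {G : Type*} [AddCommGroup G] (f : A → G) (hf : ∀ X Y : A, (X ≅ Y) → f X = f Y)
    (h : ∀ S : ShortComplex A, S.ShortExact → f S.X₂ = f S.X₁ + f S.X₃) : AbelianK₀ A →+ G :=
  QuotientAddGroup.lift _ (freeClassLift f hf) <| by
    rw [AddSubgroup.closure_le]
    rintro _ ⟨S, hS, rfl⟩
    simp [AddMonoidHom.mem_ker, freeClassLift_freeClass, h S hS]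

theorem lift_mk {G : Type*} [AddCommGroup G] (f : A → G) (hf : ∀ X Y : A, (X ≅ Y) → f X = f Y)
    (h : ∀ S : ShortComplex A, S.ShortExact → f S.X₂ = f S.X₁ + f S.X₃) (X : A) :
    lift f hf h (mk X) = f X :=
  freeClassLift_freeClass f hf X

theorem hom_ext {G : Type*} [AddCommGroup G] {f g : AbelianK₀ A →+ G}
    (h : ∀ X, f (mk X) = g (mk X)) : f = g :=
  QuotientAddGroup.addMonoidHom_ext _ (freeClass_hom_ext h)

end AbelianK₀

end AbelianK₀

namespace TriangulatedK₀

variable {T : Type u} [Category.{v} T] [HasZeroObject T] [HasShift T ℤ] [Preadditive T]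
  [∀ n : ℤ, (shiftFunctor T n).Additive] [Pretriangulated T]

theorem mk_eq_of_iso {X Y : T} (e : X ≅ Y) : TriangulatedK₀.mk X = TriangulatedK₀.mk Y :=
  congrArg QuotientAddGroup.mk (freeClass_eq_of_iso e)

theorem mk_obj₂ {D : Triangle T} (hD : D ∈ distTriang T) :
    TriangulatedK₀.mk D.obj₂ = TriangulatedK₀.mk D.obj₁ + TriangulatedK₀.mk D.obj₃ := by
  rw [← sub_eq_zero]
  exact (QuotientAddGroup.eq_zero_iff _).2 (AddSubgroup.subset_closure ⟨D, hD, rfl⟩)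

theorem mk_zero : TriangulatedK₀.mk (0 : T) = 0 := by
  simpa using mk_obj₂ (contractible_distinguished (0 : T))

/-- Comes from the triangle `X ⟶ 0 ⟶ ΣX`. -/
theorem mk_shift (X : T) : TriangulatedK₀.mk (X⟦(1 : ℤ)⟧) = -TriangulatedK₀.mk X := by
  have h := mk_obj₂ (contractible_distinguished₂ X)
  change TriangulatedK₀.mk 0 = TriangulatedK₀.mk X + TriangulatedK₀.mk (X⟦(1 : ℤ)⟧) at h
  rw [mk_zero] at h
  exact (neg_eq_of_add_eq_zero_right h.symm).symm

/-- The universal property of the Grothendieck group of a triangulated category. -/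
def lift {G : Type*} [AddCommGroup G] (f : T → G) (hf : ∀ X Y : T, (X ≅ Y) → f X = f Y)
    (h : ∀ D ∈ distTriang T, f D.obj₂ = f D.obj₁ + f D.obj₃) : TriangulatedK₀ T →+ G :=
  QuotientAddGroup.lift _ (freeClassLift f hf) <| by
    rw [AddSubgroup.closure_le]
    rintro _ ⟨D, hD, rfl⟩
    simp [AddMonoidHom.mem_ker, freeClassLift_freeClass, h D hD]

theorem lift_mk {G : Type*} [AddCommGroup G] (f : T → G) (hf : ∀ X Y : T, (X ≅ Y) → f X = f Y)
    (h : ∀ D ∈ distTriang T, f D.obj₂ = f D.obj₁ + f D.obj₃) (X : T) :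
    lift f hf h (mk X) = f X :=
  freeClassLift_freeClass f hf X

theorem hom_ext {G : Type*} [AddCommGroup G] {f g : TriangulatedK₀ T →+ G}
    (h : ∀ X, f (mk X) = g (mk X)) : f = g :=
  QuotientAddGroup.addMonoidHom_ext _ (freeClass_hom_ext h)

/-- The relation given by a distinguished triangle with vertices in a triangulated subcategory. -/
theorem mk_of_distinguished (P : ObjectProperty T) [P.IsTriangulated] {X Y Z : P.FullSubcategory}
    {f : P.ι.obj X ⟶ P.ι.obj Y} {g : P.ι.obj Y ⟶ P.ι.obj Z}
    {h : P.ι.obj Z ⟶ (P.ι.obj X)⟦(1 : ℤ)⟧} (hD : Triangle.mk f g h ∈ distTriang T) :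
    TriangulatedK₀.mk Y = TriangulatedK₀.mk X + TriangulatedK₀.mk Z := by
  -- The target of `h` is the ambient shift; it lifts to the subcategory by fullness, after
  -- correcting by the isomorphism commuting the inclusion with the shift.
  obtain ⟨d, rfl⟩ : ∃ d : Z ⟶ X⟦(1 : ℤ)⟧, P.ι.map d ≫ (P.ι.commShiftIso (1 : ℤ)).hom.app X = h :=
    ⟨P.fullyFaithfulι.preimage (h ≫ (P.ι.commShiftIso (1 : ℤ)).inv.app X), by
      rw [Functor.FullyFaithful.map_preimage, Category.assoc, Iso.inv_hom_id_app]
      exact Category.comp_id _⟩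
  exact mk_obj₂ (D := Triangle.mk (P.homMk f) (P.homMk g) d) hD

end TriangulatedK₀

/-! ### Exact sequences and classes in a wide subcategory -/

section Wide

variable {A : Type u} [Category.{v} A] [Abelian A] (W : ObjectProperty A) [IsWide W]

instance IsWide.preservesHomology_ι : W.ι.PreservesHomology where
  preservesKernels _ _ f := W.preservesKernels_ι f
  preservesCokernels _ _ f := W.preservesCokernels_ι f

theorem IsWide.shortExact_map_ι_iff (S : ShortComplex W.FullSubcategory) :
    (S.map W.ι).ShortExact ↔ S.ShortExact := by
  constructor
  · intro h
    exact
      { exact := (ShortComplex.exact_map_iff_of_faithful S W.ι).1 h.exact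
        mono_f := W.ι.mono_of_mono_map h.mono_f
        epi_g := W.ι.epi_of_epi_map h.epi_g }
  · intro h
    have := W.preservesMonomorphisms_ι_of_isNormalEpiCategory
    have := W.preservesEpimorphisms_ι_of_isNormalMonoCategory
    have := h.mono_f
    have := h.epi_g
    exact
      { exact := h.exact.map W.ι
        mono_f := inferInstanceAs (Mono (W.ι.map S.f))
        epi_g := inferInstanceAs (Epi (W.ι.map S.g)) }

/-- The class in `K₀(W)` of an object of the ambient category which belongs to `W`. -/
def wideClass (X : A) (hX : W X) : AbelianK₀ W.FullSubcategory :=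
  AbelianK₀.mk (⟨X, hX⟩ : W.FullSubcategory)

variable {W}

theorem wideClass_eq_of_iso {X Y : A} (e : X ≅ Y) (hX : W X) (hY : W Y) :
    wideClass W X hX = wideClass W Y hY :=
  AbelianK₀.mk_eq_of_iso (W.isoMk e)

theorem wideClass_eq_zero {X : A} (h : IsZero X) (hX : W X) : wideClass W X hX = 0 := by
  refine AbelianK₀.mk_eq_zero ((IsZero.iff_id_eq_zero _).2 ?_)
  ext
  exact h.eq_of_src _ _

theorem wideClass_X₂ {S : ShortComplex A} (hS : S.ShortExact) (h₁ : W S.X₁) (h₂ : W S.X₂)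
    (h₃ : W S.X₃) : wideClass W S.X₂ h₂ = wideClass W S.X₁ h₁ + wideClass W S.X₃ h₃ := by
  let S' : ShortComplex W.FullSubcategory :=
    ShortComplex.mk (X₁ := ⟨S.X₁, h₁⟩) (X₂ := ⟨S.X₂, h₂⟩) (X₃ := ⟨S.X₃, h₃⟩)
      (W.homMk S.f) (W.homMk S.g) (by ext; exact S.zero)
  exact AbelianK₀.mk_X₂ (S := S') ((IsWide.shortExact_map_ι_iff W S').1 hS)

theorem shortExact_kernel_image {X Y : A} (f : X ⟶ Y) :
    (ShortComplex.mk (kernel.ι f) (factorThruImage f)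
      (by simp [← cancel_mono (image.ι f)])).ShortExact where
  exact := by
    refine ShortComplex.exact_of_f_is_kernel _ (KernelFork.IsLimit.ofι _ _
      (fun g hg => kernel.lift f g ?_) (by simp)
      (fun g hg m hm => by simp [← cancel_mono (kernel.ι f), hm]))
    dsimp at hg
    rw [← image.fac f, reassoc_of% hg, zero_comp]

theorem shortExact_image_cokernel {X Y : A} (f : X ⟶ Y) :
    (ShortComplex.mk (image.ι f) (cokernel.π f)
      (by simp [← cancel_epi (factorThruImage f)])).ShortExact where
  exact := by
    refine ShortComplex.exact_of_g_is_cokernel _ (CokernelCofork.IsColimit.ofπ _ _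
      (fun g hg => cokernel.desc f g ?_) (by simp)
      (fun g hg m hm => by simp [← cancel_epi (cokernel.π f), hm]))
    dsimp at hg
    rw [← image.fac f, Category.assoc, hg, comp_zero]

/-- The image is the kernel of the cokernel map. -/
theorem IsWide.prop_image {X Y : A} (f : X ⟶ Y) (hX : W X) (hY : W Y) : W (image f) :=
  W.prop_of_iso (Abelian.imageIsoImage f)
    (W.prop_kernel _ hY (W.prop_cokernel f hX hY))

/-- In an exact sequence `X ⟶ Y ⟶ Z`, the middle class is determined by the outer ones and by
the kernel and the cokernel of the two maps. -/
theorem wideClass_of_exact {S : ShortComplex A} (hS : S.Exact) (h₁ : W S.X₁) (h₂ : W S.X₂)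
    (h₃ : W S.X₃) :
    wideClass W S.X₁ h₁ + wideClass W S.X₃ h₃ + -wideClass W S.X₂ h₂ =
      wideClass W (kernel S.f) (W.prop_kernel _ h₁ h₂) +
        wideClass W (cokernel S.g) (W.prop_cokernel _ h₂ h₃) := by
  -- Exactness turns the middle class into the sum of the two image classes, which then cancel
  -- against those in the outer terms.
  have e : image S.f ≅ kernel S.g :=
    IsLimit.conePointUniqueUpToIso hS.isLimitImage' (limit.isLimit _)
  have hf := IsWide.prop_image S.f h₁ h₂
  have hg := IsWide.prop_image S.g h₂ h₃
  have e₁ := wideClass_X₂ (shortExact_kernel_image S.f) (W.prop_kernel _ h₁ h₂) h₁ hf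
  have e₂ := wideClass_X₂ (shortExact_kernel_image S.g) (W.prop_kernel _ h₂ h₃) h₂ hg
  have e₃ := wideClass_X₂ (shortExact_image_cokernel S.g) hg h₃ (W.prop_cokernel _ h₂ h₃)
  dsimp only at e₁ e₂ e₃
  rw [e₁, e₂, e₃, wideClass_eq_of_iso e hf (W.prop_kernel _ h₂ h₃)]
  abel

/-- In an exact sequence `A₀ ⟶ A₁ ⟶ A₂ ⟶ A₃`, the cokernel of the first map is isomorphic to the
kernel of the last one. -/
noncomputable def cokernelIsoKernelOfExact {A₀ A₁ A₂ A₃ : A} (a : A₀ ⟶ A₁) (b : A₁ ⟶ A₂)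
    (c : A₂ ⟶ A₃) (hab : a ≫ b = 0) (hbc : b ≫ c = 0) (e₁ : (ShortComplex.mk a b hab).Exact)
    (e₂ : (ShortComplex.mk b c hbc).Exact) : cokernel a ≅ kernel c :=
  -- Exactness at `A₁` makes `φ` mono, exactness at `A₂` makes it epi.
  let φ : cokernel a ⟶ kernel c :=
    kernel.lift c (cokernel.desc a b hab) (by simp [← cancel_epi (cokernel.π a), hbc])
  have : Mono (cokernel.desc a b hab) := e₁.mono_cokernelDesc
  have : Epi (kernel.lift c b hbc) := e₂.epi_kernelLift
  have h₁ : φ ≫ kernel.ι c = cokernel.desc a b hab := by simp [φ]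
  have h₂ : cokernel.π a ≫ φ = kernel.lift c b hbc := by simp [φ, ← cancel_mono (kernel.ι c)]
  have : Mono φ := mono_of_mono_fac h₁
  have : Epi φ := epi_of_epi_fac h₂
  have : IsIso φ := isIso_of_mono_of_epi φ
  asIso φ

end Wide

/-! ### The Euler characteristic on `f(W)` -/

section

variable {R : Type u} [CommRing R] [HasDerivedCategory.{w} (ModuleCat.{u} R)]

open DerivedCategory.TStructure in
instance : (t : Triangulated.TStructure
    (DerivedCategory (ModuleCat.{u} R))).bounded.IsStableUnderRetracts where
  of_retract {X Y} r hY := by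
    have hz (n : ℤ) (h : IsZero ((DerivedCategory.homologyFunctor (ModuleCat.{u} R) n).obj Y)) :
        IsZero ((DerivedCategory.homologyFunctor (ModuleCat.{u} R) n).obj X) :=
      (IsZero.iff_id_eq_zero _).2 (by
        rw [← (r.map (DerivedCategory.homologyFunctor (ModuleCat.{u} R) n)).retract]
        exact (h.eq_of_tgt _ 0) =≫ _ |>.trans zero_comp)
    obtain ⟨⟨a, ha⟩, ⟨b, hb⟩⟩ := hY
    exact ⟨⟨a, (DerivedCategory.isGE_iff X a).2
        (fun i hi => hz i ((DerivedCategory.isGE_iff Y a).1 ha i hi))⟩,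
      ⟨b, (DerivedCategory.isLE_iff X b).2
        (fun i hi => hz i ((DerivedCategory.isLE_iff Y b).1 hb i hi))⟩⟩

-- Bounded complexes form a thick subcategory containing `R`, so minimality of the thick envelope
-- applies.
open DerivedCategory.TStructure in
theorem perfectComplexes_le_bounded :
    perfectComplexes R ≤ (t : Triangulated.TStructure
      (DerivedCategory (ModuleCat.{u} R))).bounded := by
  refine (ObjectProperty.triangEnvelope_le_iff _).2 ?_
  rw [ObjectProperty.singleton_le_iff]
  exact ⟨⟨0, inferInstance⟩, ⟨0, inferInstance⟩⟩

/-- A perfect complex has only finitely many nonzero homology modules. -/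
theorem finite_homology {X : DerivedCategory (ModuleCat.{u} R)} (hX : perfectComplexes R X) :
    {i : ℤ | ¬ IsZero (homologyModule R i X)}.Finite := by
  obtain ⟨⟨a, ha⟩, ⟨b, hb⟩⟩ := perfectComplexes_le_bounded X hX
  -- Cohomological amplitude `[a, b]` is homological amplitude `[-b, -a]`.
  refine (Set.finite_Icc (-b) (-a)).subset fun i hi => ?_
  by_contra h
  rw [Set.mem_Icc, not_and_or, not_le, not_le] at h
  apply hi
  rcases h with h | h
  · exact DerivedCategory.isZero_of_isLE X b (-i) (by lia)
  · exact DerivedCategory.isZero_of_isGE X a (-i) (by lia)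

variable (W : ObjectProperty (ModuleCat.{u} R))

theorem prop_homology (X : (perfectWithHomologyIn W).FullSubcategory) (n : ℤ) :
    W ((DerivedCategory.homologyFunctor (ModuleCat.{u} R) n).obj X.obj) :=
  (homologyIn_iff W X.obj).1 X.property.2 n

variable [IsWide W]

/-- The alternating sum of the classes of the homology modules of a complex. -/
noncomputable def eulerChar (X : (perfectWithHomologyIn W).FullSubcategory) :
    AbelianK₀ W.FullSubcategory :=
  ∑ᶠ i : ℤ, (i.negOnePow : ℤ) • wideClass W (homologyModule R i X.obj) (X.property.2 i)

variable {W}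

/-- `finsum` is zero by default on infinite support, so additivity needs finiteness. The general `g`
covers both homology classes and the kernel classes in `eulerChar_obj₂`. -/
theorem finite_support_smul_of_isZero (s : ℤ → ℤ) (g : ℤ → AbelianK₀ W.FullSubcategory)
    (X : (perfectWithHomologyIn W).FullSubcategory)
    (hg : ∀ i, IsZero (homologyModule R i X.obj) → g i = 0) :
    (Function.support fun i => s i • g i).Finite :=
  (finite_homology X.property.1).subset fun i hi h => hi (by simp [hg i h])

theorem eulerChar_eq_of_iso {X Y : (perfectWithHomologyIn W).FullSubcategory} (e : X ≅ Y) :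
    eulerChar W X = eulerChar W Y :=
  finsum_congr fun i => congrArg _ (wideClass_eq_of_iso
    ((DerivedCategory.homologyFunctor _ (-i)).mapIso ((ObjectProperty.ι _).mapIso e)) _ _)

/-- The Euler characteristic is additive on distinguished triangles. -/
theorem eulerChar_obj₂ {D : Triangle (perfectWithHomologyIn W).FullSubcategory}
    (hD : D ∈ distTriang (perfectWithHomologyIn W).FullSubcategory) :
    eulerChar W D.obj₂ = eulerChar W D.obj₁ + eulerChar W D.obj₃ := by
  let T := (perfectWithHomologyIn W).ι.mapTriangle.obj D
  have hT : T ∈ distTriang (DerivedCategory (ModuleCat.{u} R)) := hD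
  have h₁ (n : ℤ) : W ((DerivedCategory.homologyFunctor (ModuleCat.{u} R) n).obj T.obj₁) :=
    prop_homology W D.obj₁ n
  have h₂ (n : ℤ) : W ((DerivedCategory.homologyFunctor (ModuleCat.{u} R) n).obj T.obj₂) :=
    prop_homology W D.obj₂ n
  have h₃ (n : ℤ) : W ((DerivedCategory.homologyFunctor (ModuleCat.{u} R) n).obj T.obj₃) :=
    prop_homology W D.obj₃ n
  let f (n : ℤ) := (DerivedCategory.homologyFunctor (ModuleCat.{u} R) n).map T.mor₁
  let k (n : ℤ) := wideClass W (kernel (f n)) (W.prop_kernel _ (h₁ n) (h₂ n))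
  have hk (n : ℤ) : wideClass W _ (h₁ n) + wideClass W _ (h₃ n) + -wideClass W _ (h₂ n) =
      k n + k (n + 1) := by
    rw [wideClass_of_exact (DerivedCategory.HomologySequence.exact₂ T hT n) (h₁ n) (h₂ n) (h₃ n)]
    congr 1
    -- The connecting map identifies the cokernel in degree `n` with the kernel in degree `n + 1`.
    exact wideClass_eq_of_iso (cokernelIsoKernelOfExact _ _ _ _ _
      (DerivedCategory.HomologySequence.exact₃ T hT n (n + 1))
      (DerivedCategory.HomologySequence.exact₁ T hT n (n + 1))) _ _
  have hk0 (i : ℤ) (hi : IsZero (homologyModule R i D.obj₁.obj)) : k (-i) = 0 :=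
    wideClass_eq_zero (IsZero.of_mono (kernel.ι (f (-i))) hi) _
  let a₁ (i : ℤ) := (i.negOnePow : ℤ) • wideClass W _ (D.obj₁.property.2 i)
  let a₂ (i : ℤ) := (i.negOnePow : ℤ) • wideClass W _ (D.obj₂.property.2 i)
  let a₃ (i : ℤ) := (i.negOnePow : ℤ) • wideClass W _ (D.obj₃.property.2 i)
  have s₁ : (Function.support a₁).Finite := finite_support_smul_of_isZero _ _ D.obj₁
    (fun i hi => wideClass_eq_zero hi (D.obj₁.property.2 i))
  have s₂ : (Function.support a₂).Finite := finite_support_smul_of_isZero _ _ D.obj₂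
    (fun i hi => wideClass_eq_zero hi (D.obj₂.property.2 i))
  have s₃ : (Function.support a₃).Finite := finite_support_smul_of_isZero _ _ D.obj₃
    (fun i hi => wideClass_eq_zero hi (D.obj₃.property.2 i))
  have s₄ := finite_support_smul_of_isZero (W := W) (fun i => (i.negOnePow : ℤ))
    (fun i => k (-i)) D.obj₁ hk0
  -- Reindexing by `i ↦ i - 1` flips the sign, so the two kernel sums cancel.
  let e : ℤ ≃ ℤ := Equiv.subRight 1
  have hshift (i : ℤ) : (i.negOnePow : ℤ) • k (-i + 1) =
      -(((e i).negOnePow : ℤ) • k (-(e i))) := by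
    have : -(e i) = -i + 1 := by simp [e]; ring
    rw [this]
    simp [e, Int.negOnePow_sub]
  have s₅ : (Function.support fun i : ℤ => (i.negOnePow : ℤ) • k (-i + 1)).Finite := by
    simp_rw [hshift, Function.support_fun_neg]
    exact s₄.preimage e.injective.injOn
  have h0 : ∑ᶠ i : ℤ, ((i.negOnePow : ℤ) • k (-i) + (i.negOnePow : ℤ) • k (-i + 1)) = 0 := by
    rw [finsum_add_distrib s₄ s₅]
    simp_rw [hshift]
    rw [finsum_neg_distrib, finsum_comp_equiv e (f := fun i => (i.negOnePow : ℤ) • k (-i)),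
      add_neg_cancel]
  have ha (i : ℤ) : a₁ i + a₃ i + -a₂ i =
      (i.negOnePow : ℤ) • k (-i) + (i.negOnePow : ℤ) • k (-i + 1) := by
    rw [← smul_add ((i.negOnePow : ℤ)) (k (-i)), ← hk, smul_add, smul_add, smul_neg]
    rfl
  have s₁₃ : (Function.support fun i => a₁ i + a₃ i).Finite :=
    (s₁.union s₃).subset (Function.support_add _ _)
  have s₂' : (Function.support fun i => -a₂ i).Finite := by
    rwa [Function.support_fun_neg]
  have h1 : eulerChar W D.obj₁ + eulerChar W D.obj₃ + -eulerChar W D.obj₂ = 0 := by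
    change ∑ᶠ i, a₁ i + ∑ᶠ i, a₃ i + -∑ᶠ i, a₂ i = 0
    rw [← finsum_neg_distrib, ← finsum_add_distrib s₁ s₃, ← finsum_add_distrib s₁₃ s₂',
      finsum_congr ha, h0]
  rw [← sub_eq_add_neg, sub_eq_zero] at h1
  exact h1.symm

variable (W) in
/-- The homomorphism `K₀(f(W)) ⟶ K₀(W)` given by the Euler characteristic. -/
noncomputable def eulerCharHom :
    TriangulatedK₀ (perfectWithHomologyIn W).FullSubcategory →+ AbelianK₀ W.FullSubcategory :=
  TriangulatedK₀.lift (eulerChar W) (fun _ _ e => eulerChar_eq_of_iso e)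
    (fun _ hD => eulerChar_obj₂ hD)

theorem eulerCharHom_mk (X : (perfectWithHomologyIn W).FullSubcategory) :
    eulerCharHom W (TriangulatedK₀.mk X) = eulerChar W X :=
  TriangulatedK₀.lift_mk _ _ _ X

/-! ### Modules as complexes in degree zero -/

theorem isZero_homology_single (M : ModuleCat.{u} R) (n : ℤ) (hn : n ≠ 0) :
    IsZero ((DerivedCategory.homologyFunctor (ModuleCat.{u} R) n).obj (inDegreeZero R M)) := by
  rcases lt_or_gt_of_ne hn with h | h
  · exact DerivedCategory.isZero_of_isGE _ 0 n h
  · exact DerivedCategory.isZero_of_isLE _ 0 n h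

theorem homologyIn_single {M : ModuleCat.{u} R} (hM : W M) : homologyIn W (inDegreeZero R M) := by
  rw [homologyIn_iff]
  intro n
  by_cases hn : n = 0
  · subst hn
    exact W.prop_of_iso
      ((DerivedCategory.singleFunctorCompHomologyFunctorIso (ModuleCat.{u} R) 0).app M).symm hM
  · exact W.prop_of_isZero (isZero_homology_single M n hn)

theorem eulerChar_single {M : ModuleCat.{u} R} (hM : W M)
    (h : perfectWithHomologyIn W (inDegreeZero R M)) :
    eulerChar W ⟨inDegreeZero R M, h⟩ = wideClass W M hM := by
  unfold eulerChar
  rw [finsum_eq_single _ 0]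
  · simp only [Int.negOnePow_zero, Units.val_one, one_smul]
    exact wideClass_eq_of_iso
      ((DerivedCategory.singleFunctorCompHomologyFunctorIso (ModuleCat.{u} R) 0).app M) _ _
  · intro i hi
    rw [wideClass_eq_zero (isZero_homology_single M (-i) (by simpa using hi)), smul_zero]

theorem perfectWithHomologyIn_single (hp : W ≤ perfectModules R) {M : ModuleCat.{u} R}
    (hM : W M) : perfectWithHomologyIn W (inDegreeZero R M) :=
  ⟨hp _ hM, homologyIn_single hM⟩

/-- The homomorphism `K₀(W) ⟶ K₀(f(W))` sending the class of `M` to the class of `M[0]`. -/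
noncomputable def inDegreeZeroHom (hp : W ≤ perfectModules R) :
    AbelianK₀ W.FullSubcategory →+ TriangulatedK₀ (perfectWithHomologyIn W).FullSubcategory :=
  AbelianK₀.lift
    (fun M => TriangulatedK₀.mk
      ⟨inDegreeZero R M.obj, perfectWithHomologyIn_single hp M.property⟩)
    (fun _ _ e => TriangulatedK₀.mk_eq_of_iso ((perfectWithHomologyIn W).isoMk
      ((DerivedCategory.singleFunctor _ 0).mapIso (W.ι.mapIso e))))
    (fun S hS => TriangulatedK₀.mk_of_distinguished (perfectWithHomologyIn W)
      ((IsWide.shortExact_map_ι_iff W S).2 hS).singleTriangle_distinguished)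

theorem inDegreeZeroHom_mk (hp : W ≤ perfectModules R) (M : W.FullSubcategory) :
    inDegreeZeroHom hp (AbelianK₀.mk M) = TriangulatedK₀.mk
      ⟨inDegreeZero R M.obj, perfectWithHomologyIn_single hp M.property⟩ :=
  AbelianK₀.lift_mk _ _ _ M

theorem eulerCharHom_inDegreeZeroHom_mk (hp : W ≤ perfectModules R) (M : W.FullSubcategory) :
    eulerCharHom W (inDegreeZeroHom hp (AbelianK₀.mk M)) = AbelianK₀.mk M := by
  rw [inDegreeZeroHom_mk, eulerCharHom_mk, eulerChar_single M.property]
  rfl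

/-! ### Dévissage of `f(W)` by truncation -/

/-- A complex concentrated in a single degree, whose homology module is perfect, is perfect. -/
theorem perfectComplexes_of_isGE_of_isLE (X : DerivedCategory (ModuleCat.{u} R)) (n : ℤ)
    [X.IsGE n] [X.IsLE n]
    (h : perfectModules R ((DerivedCategory.homologyFunctor (ModuleCat.{u} R) n).obj X)) :
    perfectComplexes R X := by
  obtain ⟨M, ⟨e⟩⟩ := DerivedCategory.exists_iso_singleFunctor_obj_of_isGE_of_isLE X n
  have hM : perfectModules R M := (perfectModules R).prop_of_iso
    ((DerivedCategory.homologyFunctor (ModuleCat.{u} R) n).mapIso e ≪≫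
      (DerivedCategory.singleFunctorCompHomologyFunctorIso (ModuleCat.{u} R) n).app M) h
  exact (perfectComplexes R).prop_of_iso
    ((((DerivedCategory.singleFunctors (ModuleCat.{u} R)).shiftIso (-n) n 0 (by simp)).app M) ≪≫
      e.symm)
    ((perfectComplexes R).le_shift (-n) _ hM)

/-- The composition `K₀(f(W)) ⟶ K₀(W) ⟶ K₀(f(W))` fixes the class of a complex concentrated in
degree zero. -/
theorem inDegreeZeroHom_eulerChar_of_degree_zero (hp : W ≤ perfectModules R)
    (X : (perfectWithHomologyIn W).FullSubcategory) [X.obj.IsGE 0] [X.obj.IsLE 0] :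
    inDegreeZeroHom hp (eulerCharHom W (TriangulatedK₀.mk X)) = TriangulatedK₀.mk X := by
  obtain ⟨M, ⟨e⟩⟩ := DerivedCategory.exists_iso_singleFunctor_obj_of_isGE_of_isLE X.obj 0
  have hM : W M := W.prop_of_iso
    ((DerivedCategory.homologyFunctor (ModuleCat.{u} R) 0).mapIso e ≪≫
      (DerivedCategory.singleFunctorCompHomologyFunctorIso (ModuleCat.{u} R) 0).app M)
    (prop_homology W X 0)
  have hX : TriangulatedK₀.mk X = inDegreeZeroHom hp (AbelianK₀.mk ⟨M, hM⟩) := by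
    rw [inDegreeZeroHom_mk]
    exact TriangulatedK₀.mk_eq_of_iso ((perfectWithHomologyIn W).isoMk e)
  rw [hX, eulerCharHom_inDegreeZeroHom_mk]

theorem inDegreeZeroHom_eulerChar_of_shift (hp : W ≤ perfectModules R)
    (X : (perfectWithHomologyIn W).FullSubcategory)
    (h : inDegreeZeroHom hp (eulerCharHom W (TriangulatedK₀.mk (X⟦(1 : ℤ)⟧))) =
      TriangulatedK₀.mk (X⟦(1 : ℤ)⟧)) :
    inDegreeZeroHom hp (eulerCharHom W (TriangulatedK₀.mk X)) = TriangulatedK₀.mk X := by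
  simpa [TriangulatedK₀.mk_shift] using h

-- The shift of the subcategory agrees with the ambient one only through `commShiftIso`, so the
-- bound is transported along it.
open DerivedCategory.TStructure in
theorem isGE_shift_obj (X : (perfectWithHomologyIn W).FullSubcategory) (n a n' : ℤ)
    (h : a + n' = n) [X.obj.IsGE n] : (X⟦a⟧).obj.IsGE n' := by
  have : t.IsGE (((perfectWithHomologyIn W).ι ⋙ shiftFunctor _ a).obj X) n' :=
    t.isGE_shift X.obj n a n' h
  exact t.isGE_of_iso (((perfectWithHomologyIn W).ι.commShiftIso a).symm.app X) n'

open DerivedCategory.TStructure in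
theorem isLE_shift_obj (X : (perfectWithHomologyIn W).FullSubcategory) (n a n' : ℤ)
    (h : a + n' = n) [X.obj.IsLE n] : (X⟦a⟧).obj.IsLE n' := by
  have : t.IsLE (((perfectWithHomologyIn W).ι ⋙ shiftFunctor _ a).obj X) n' :=
    t.isLE_shift X.obj n a n' h
  exact t.isLE_of_iso (((perfectWithHomologyIn W).ι.commShiftIso a).symm.app X) n'

theorem inDegreeZeroHom_eulerChar_of_single_degree (hp : W ≤ perfectModules R) (n : ℤ)
    (X : (perfectWithHomologyIn W).FullSubcategory) [X.obj.IsGE n] [X.obj.IsLE n] :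
    inDegreeZeroHom hp (eulerCharHom W (TriangulatedK₀.mk X)) = TriangulatedK₀.mk X := by
  induction n generalizing X with
  | zero => exact inDegreeZeroHom_eulerChar_of_degree_zero hp X
  | succ n ih =>
    apply inDegreeZeroHom_eulerChar_of_shift
    have : (X⟦(1 : ℤ)⟧).obj.IsGE n := isGE_shift_obj X (n + 1) 1 n (by lia)
    have : (X⟦(1 : ℤ)⟧).obj.IsLE n := isLE_shift_obj X (n + 1) 1 n (by lia)
    exact ih _
  | pred n ih =>
    have e : X ≅ (X⟦(-1 : ℤ)⟧)⟦(1 : ℤ)⟧ :=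
      ((shiftEquiv (perfectWithHomologyIn W).FullSubcategory (1 : ℤ)).counitIso.app X).symm
    have : (X⟦(-1 : ℤ)⟧).obj.IsGE (-n) := isGE_shift_obj X (-n - 1) (-1) (-n) (by lia)
    have : (X⟦(-1 : ℤ)⟧).obj.IsLE (-n) := isLE_shift_obj X (-n - 1) (-1) (-n) (by lia)
    have h := ih (X⟦(-1 : ℤ)⟧)
    rw [TriangulatedK₀.mk_eq_of_iso e, TriangulatedK₀.mk_shift, map_neg, map_neg, h]

open DerivedCategory.TStructure in
/-- If an object of `f(W)` has cohomology in degrees `≤ n`, its truncation in degrees `≥ n` belongs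
to `f(W)`. -/
theorem perfectWithHomologyIn_truncGE (hp : W ≤ perfectModules R)
    (X : DerivedCategory (ModuleCat.{u} R)) (hX : perfectWithHomologyIn W X) (n : ℤ) [X.IsLE n] :
    perfectWithHomologyIn W ((t.truncGE n).obj X) := by
  let Y := (t.truncGE n).obj X
  let Z := (t.truncLT n).obj X
  have hT := t.triangleLTGE_distinguished n X
  have : Z.IsLE (n - 1) := inferInstance
  have : Y.IsGE n := inferInstance
  have : Y.IsLE n := inferInstance
  have hX' := (homologyIn_iff W X).1 hX.2
  have hZ (i : ℤ) (hi : n ≤ i) :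
      W ((DerivedCategory.homologyFunctor (ModuleCat.{u} R) i).obj Z) :=
    W.prop_of_isZero (DerivedCategory.isZero_of_isLE Z (n - 1) i (by lia))
  -- The cohomology of `Z` vanishes in degrees `n` and `n + 1`, so `Y` inherits its degree `n`
  -- cohomology from `X`.
  have hY : W ((DerivedCategory.homologyFunctor (ModuleCat.{u} R) n).obj Y) :=
    IsWide.prop_of_exact W _ _ _ _ _ _ _
      (DerivedCategory.HomologySequence.exact₂ _ hT n)
      (DerivedCategory.HomologySequence.exact₃ _ hT n (n + 1))
      (DerivedCategory.HomologySequence.exact₁ _ hT n (n + 1))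
      (hZ n le_rfl) (hX' n) (hZ (n + 1) (by lia)) (hX' (n + 1))
  -- Truncations of perfect complexes need not be perfect in general; here `hp` supplies it.
  refine ⟨perfectComplexes_of_isGE_of_isLE Y n (hp _ hY), (homologyIn_iff W Y).2 fun i => ?_⟩
  rcases lt_trichotomy i n with h | rfl | h
  · exact W.prop_of_isZero (DerivedCategory.isZero_of_isGE Y n i h)
  · exact hY
  · exact W.prop_of_isZero (DerivedCategory.isZero_of_isLE Y n i h)

open DerivedCategory.TStructure in
theorem inDegreeZeroHom_eulerChar (hp : W ≤ perfectModules R)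
    (X : (perfectWithHomologyIn W).FullSubcategory) :
    inDegreeZeroHom hp (eulerCharHom W (TriangulatedK₀.mk X)) = TriangulatedK₀.mk X := by
  obtain ⟨⟨a, ha⟩, ⟨b, hb⟩⟩ := perfectComplexes_le_bounded _ X.property.1
  -- Induction on amplitude with `a` fixed: `m` bounds the number of degrees in `[a, b]`, and `m =
  -- 0` forces `b < a`, hence `X = 0`.
  obtain ⟨m, hm⟩ : ∃ m : ℕ, b < a + m := ⟨(b + 1 - a).toNat, by lia⟩
  induction m generalizing X b with
  | zero =>
    have hz : IsZero X := (IsZero.iff_id_eq_zero _).2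
      (by ext; exact (t.isZero X.obj b a (by lia)).eq_of_src _ _)
    rw [TriangulatedK₀.mk_eq_of_iso (hz.iso (isZero_zero _)), TriangulatedK₀.mk_zero, map_zero,
      map_zero]
  | succ m ih =>
    have hT := t.triangleLTGE_distinguished b X.obj
    have hY := perfectWithHomologyIn_truncGE hp X.obj X.property b
    let Y : (perfectWithHomologyIn W).FullSubcategory := ⟨(t.truncGE b).obj X.obj, hY⟩
    -- The lower truncation lies in `f(W)` as the remaining vertex of the triangle.
    let Z : (perfectWithHomologyIn W).FullSubcategory := ⟨(t.truncLT b).obj X.obj,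
      (perfectWithHomologyIn W).ext_of_isTriangulatedClosed₁ _ hT X.property hY⟩
    have hXYZ : TriangulatedK₀.mk X = TriangulatedK₀.mk Z + TriangulatedK₀.mk Y :=
      TriangulatedK₀.mk_of_distinguished (perfectWithHomologyIn W) hT
    have : Y.obj.IsGE b := inferInstanceAs (t.IsGE ((t.truncGE b).obj X.obj) b)
    have : Y.obj.IsLE b := inferInstanceAs (t.IsLE ((t.truncGE b).obj X.obj) b)
    have hZ := ih Z (inferInstanceAs (t.IsGE ((t.truncLT b).obj X.obj) a)) (b - 1)
      (inferInstanceAs (t.IsLE ((t.truncLT b).obj X.obj) (b - 1))) (by lia)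
    rw [hXYZ, map_add, map_add, hZ, inDegreeZeroHom_eulerChar_of_single_degree hp b Y]

/-- The Grothendieck groups of a wide subcategory consisting of perfect modules and of the
category of perfect complexes with homology in it are isomorphic. -/
noncomputable def inDegreeZeroEquiv (hp : W ≤ perfectModules R) :
    AbelianK₀ W.FullSubcategory ≃+ TriangulatedK₀ (perfectWithHomologyIn W).FullSubcategory :=
  AddMonoidHom.toAddEquiv (inDegreeZeroHom hp) (eulerCharHom W)
    (AbelianK₀.hom_ext fun M => eulerCharHom_inDegreeZeroHom_mk hp M)
    (TriangulatedK₀.hom_ext fun X => inDegreeZeroHom_eulerChar hp X)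

end

end WideSubcategory

open WideSubcategory

theorem theorem3p3 {R : Type u} [CommRing R] [HasDerivedCategory.{w} (ModuleCat.{u} R)]
    (hcoh : IsCoherentRing R) (hreg : IsRegularCommRing R)
    (W : ObjectProperty (ModuleCat.{u} R)) [IsWide W]
    (hW : ∀ M : ModuleCat.{u} R, W M → Module.FinitePresentation R M) :
    ∃ e : AbelianK₀ W.FullSubcategory ≃+ TriangulatedK₀ (perfectWithHomologyIn W).FullSubcategory,
      (∀ M : W.FullSubcategory, ∃ hM : perfectWithHomologyIn W (inDegreeZero R M.obj),
        e (AbelianK₀.mk M) = TriangulatedK₀.mk ⟨inDegreeZero R M.obj, hM⟩) ∧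
      (∀ X : (perfectWithHomologyIn W).FullSubcategory,
        {i : ℤ | ¬ IsZero (homologyModule R i X.obj)}.Finite ∧
        e.symm (TriangulatedK₀.mk X) =
          ∑ᶠ i : ℤ, (i.negOnePow : ℤ) •
            AbelianK₀.mk (⟨homologyModule R i X.obj, X.property.2 i⟩ : W.FullSubcategory)) := by
  have hp : W ≤ perfectModules R := fun M hM =>
    have := hW M hM
    perfectModules_of_finitePresentation hcoh hreg M
  exact ⟨inDegreeZeroEquiv hp, fun M => ⟨perfectWithHomologyIn_single hp M.property,
    inDegreeZeroHom_mk hp M⟩, fun X => ⟨finite_homology X.property.1, eulerCharHom_mk X⟩⟩
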